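/- **Theorem (Barron's counterexample is $\ln 2$-inconsistent at the uniform density).** Let $\mathbb X=[0,1)$ with its Borel $\sigma$-algebra and Lebesgue measure $\lambda$, and let $\Phi$ be the standard normal distribution function. For $\theta\in[0,1]$ put $$f_\theta(x)=\exp\{-\theta+\sqrt{2\theta}\,\Phi^{-1}(x)\}\quad(x\in[0,1)),$$ with $f_\theta(0)=0$ for $\theta>0$ and $f_0\equiv 1$, and let $\mathbb F_0=\{f_\theta:\theta\in[0,1]\}$. For $N\in\{1,2,\dots\}$ let $\mathbb F_N$ be the set of the $\binom{2N^2}{N^2}$ densities on $[0,1)$ that equal $2$ on exactly $N^2$ of the $2N^2$ intervals $\big[\tfrac{j}{2N^2},\tfrac{j+1}{2N^2}\big)$, $j=0,\dots,2N^2-1$, and equal $0$ on the other $N^2$. Let $\mathbb F=\mathbb F_0\cup\bigcup_{N\ge1}\mathbb F_N$, a set of probability densities with respect to $\lambda$, with the Borel $\sigma$-algebra of the topology of weak convergence of the corresponding probability measures. Let $\Pi=\tfrac12\Pi_0+\tfrac12\Pi_\triangle$ be the prior probability measure on $\mathbb F$, where $\Pi_0$ is the image under $\theta\mapsto f_\theta$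 of the probability measure on $[0,1]$ with Lebesgue density proportional to $e^{-1/\theta}$, and $\Pi_\triangle$ is the probability measure $$\Pi_\triangle\ \propto\ \sum_{N\ge1}\frac1{N^2}\sum_{g\in\mathbb F_N}\binom{2N^2}{N^2}^{-1}\delta_g .$$ Let $f_\star=f_0$ be the uniform density, let $X_1,X_2,\dots$ be iid uniform on $[0,1)$, and let $$R_n(f)=\prod_{i=1}^n\frac{f(X_i)}{f_\star(X_i)},\qquad \Pi(A\mid X_{1:n})=\frac{\int_A R_n(f)\,\Pi(\mathrm df)}{\int_{\mathbb F}R_n(g)\,\Pi(\mathrm dg)} .$$ Then the posterior is $\ln 2$-inconsistent at the uniform density, that is, $$\limsup_{n\to\infty}\Pi\big(\{f\in\mathbb F: R_n(f)=e^{n\ln 2}=2^n\}\,\big|\,X_{1:n}\big)=1\qquad\text{almost surely.}$$ -/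

import Mathlib

open MeasureTheory ProbabilityTheory Filter Topology Set
open scoped ENNReal NNReal unitInterval

noncomputable section

/-! ### Bayesian density estimation: the general framework -/

/-- Probability densities with respect to a measure `lam` on `X`. -/
structure ProbDensity {X : Type*} [MeasurableSpace X] (lam : Measure X) where
  toFun : X → ℝ
  measurable_toFun : Measurable toFun
  nonneg : ∀ x, 0 ≤ toFun x
  lintegral_eq_one : ∫⁻ x, ENNReal.ofReal (toFun x) ∂lam = 1

namespace ProbDensity

variable {X : Type*} [MeasurableSpace X] {lam : Measure X}

instance : CoeFun (ProbDensity lam) (fun _ => X → ℝ) := ⟨toFun⟩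

/-- The probability measure with density `f`. -/
def toMeasure (f : ProbDensity lam) : ProbabilityMeasure X :=
  ⟨lam.withDensity (fun x => ENNReal.ofReal (f x)), ⟨by
    rw [withDensity_apply _ MeasurableSet.univ, Measure.restrict_univ]
    exact f.lintegral_eq_one⟩⟩

/-- The topology of weak convergence of probability measures, on densities. -/
instance [TopologicalSpace X] [OpensMeasurableSpace X] : TopologicalSpace (ProbDensity lam) :=
  TopologicalSpace.induced toMeasure inferInstance

/-- Densities carry the Borel σ-algebra of the topology of weak convergence; a family
`F : Set (ProbDensity lam)` carries the subspace topology and its Borel σ-algebra. -/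
instance [TopologicalSpace X] [OpensMeasurableSpace X] : MeasurableSpace (ProbDensity lam) :=
  borel _

instance [TopologicalSpace X] [OpensMeasurableSpace X] : BorelSpace (ProbDensity lam) := ⟨rfl⟩

end ProbDensity

/-- The likelihood ratio `R_n(f) = ∏_{i ≤ n} f(X_i) / f⋆(X_i)` at the data `x 0, …, x (n-1)`. -/
def likelihoodRatio {X : Type*} [MeasurableSpace X] {lam : Measure X}
    (fstar : ProbDensity lam) (x : ℕ → X) (n : ℕ) (f : ProbDensity lam) : ℝ :=
  ∏ i ∈ Finset.range n, f (x i) / fstar (x i)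

/-- The posterior `Π(df | X_{1:n}) = R_n(f) Π(df) / ∫ R_n(g) Π(dg)`. -/
def posterior {X : Type*} [TopologicalSpace X] [MeasurableSpace X] [OpensMeasurableSpace X]
    {lam : Measure X} {F : Set (ProbDensity lam)} (prior : Measure F)
    (fstar : ProbDensity lam) (x : ℕ → X) (n : ℕ) : Measure F :=
  (∫⁻ g : F, ENNReal.ofReal (likelihoodRatio fstar x n g) ∂prior)⁻¹ •
    prior.withDensity (fun f : F => ENNReal.ofReal (likelihoodRatio fstar x n f))

/-- The law `F⋆^∞` of an iid sequence with density `fstar`. -/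
def iidLaw {X : Type*} [MeasurableSpace X] {lam : Measure X} (fstar : ProbDensity lam) :
    Measure (ℕ → X) :=
  Measure.infinitePi (fun _ : ℕ => (fstar.toMeasure : Measure X))

/-- `γ`-inconsistency of the posterior at the true density `fstar`:
`limsup_n Π({f ∈ F : R_n(f) = e^{γ n}} | X_{1:n}) = 1` almost surely. -/
def GammaInconsistent {X : Type*} [TopologicalSpace X] [MeasurableSpace X]
    [OpensMeasurableSpace X] {lam : Measure X} {F : Set (ProbDensity lam)}
    (prior : Measure F) [IsProbabilityMeasure prior] (fstar : ProbDensity lam) (γ : ℝ) : Prop :=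
  ∀ᵐ x ∂(iidLaw fstar),
    limsup (fun n : ℕ => posterior prior fstar x n
      {f : F | likelihoodRatio fstar x n f = Real.exp (γ * n)}) atTop = 1

/-- The normalization `μ / μ(univ)` of a measure. -/
def normalizedMeasure {α : Type*} [MeasurableSpace α] (μ : Measure α) : Measure α :=
  (μ univ)⁻¹ • μ

theorem isProbabilityMeasure_normalizedMeasure {α : Type*} [MeasurableSpace α] (μ : Measure α)
    (h0 : μ univ ≠ 0) (h1 : μ univ ≠ ∞) : IsProbabilityMeasure (normalizedMeasure μ) :=
  ⟨by simp [normalizedMeasure, ENNReal.inv_mul_cancel h0 h1]⟩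

/-! ### Barron's model -/

namespace Barron

/-- The sample space `[0,1)`. -/
abbrev Sample : Type := Set.Ico (0 : ℝ) 1

/-- Lebesgue measure on `[0,1)`. -/
def lebesgue : Measure Sample := Measure.comap Subtype.val volume

theorem lebesgue_apply (s : Set ℝ) :
    lebesgue ((↑) ⁻¹' s : Set Sample) = volume (s ∩ Set.Ico 0 1) := by
  rw [lebesgue, comap_subtype_coe_apply measurableSet_Ico, Subtype.image_preimage_coe,
    Set.inter_comm]

instance : IsProbabilityMeasure lebesgue := ⟨by
  have := lebesgue_apply univ
  simpa using this⟩

/-- The standard normal cumulative distribution function `Φ`. -/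
def Phi (t : ℝ) : ℝ := cdf (gaussianReal 0 1) t

/-- The inverse `Φ⁻¹` on `(0,1)`, as the quantile function. -/
def PhiInv (x : ℝ) : ℝ := sInf {t : ℝ | x ≤ Phi t}

theorem PhiInv_le_iff {x : ℝ} (h0 : 0 < x) (h1 : x < 1) (t : ℝ) :
    PhiInv x ≤ t ↔ x ≤ Phi t := by
  have hbdd : BddBelow {t : ℝ | x ≤ Phi t} := by
    obtain ⟨b, hb⟩ := ((tendsto_cdf_atBot (gaussianReal 0 1)).eventually_lt_const h0).exists
    refine ⟨b, fun s hs => ?_⟩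
    by_contra hlt
    have := monotone_cdf (gaussianReal 0 1) (not_le.mp hlt).le
    exact absurd hs (not_le.mpr (lt_of_le_of_lt this hb))
  have hne : {t : ℝ | x ≤ Phi t}.Nonempty := by
    obtain ⟨b, hb⟩ := ((tendsto_cdf_atTop (gaussianReal 0 1)).eventually_const_lt h1).exists
    exact ⟨b, hb.le⟩
  refine ⟨fun h => ?_, fun h => csInf_le hbdd h⟩
  have hgt : ∀ s, t < s → x ≤ Phi s := fun s hs => by
    obtain ⟨u, hu, hus⟩ := (csInf_lt_iff hbdd hne).mp (lt_of_le_of_lt h hs)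
    exact le_trans hu (monotone_cdf _ hus.le)
  have hc := ((cdf (gaussianReal 0 1)).right_continuous t).tendsto.mono_left
    (nhdsWithin_mono t Ioi_subset_Ici_self)
  exact ge_of_tendsto hc (by filter_upwards [self_mem_nhdsWithin] with s hs using hgt s hs)

theorem measurable_PhiInv : Measurable (fun x : Sample => PhiInv x) := by
  refine measurable_of_Iic fun t => ?_
  have : (fun x : Sample => PhiInv x) ⁻¹' Iic t
      = (((↑) ⁻¹' {(0 : ℝ)}) ∩ {_x : Sample | PhiInv 0 ≤ t}) ∪ ((↑) ⁻¹' Ioc (0 : ℝ) (Phi t)) := by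
    ext x
    rcases x.2.1.eq_or_lt with h | h
    · simp [← h]
    · simp [PhiInv_le_iff h x.2.2, h, h.ne']
  rw [this]
  exact ((measurable_subtype_coe (measurableSet_singleton _)).inter (MeasurableSet.const _)).union
    (measurable_subtype_coe measurableSet_Ioc)

theorem ae_pos : ∀ᵐ x : Sample ∂lebesgue, 0 < (x : ℝ) := by
  rw [ae_iff]
  refine measure_mono_null (t := (↑) ⁻¹' {(0 : ℝ)}) (fun x hx => ?_) ?_
  · exact le_antisymm (not_lt.mp hx) x.2.1
  · rw [lebesgue_apply]
    exact measure_mono_null inter_subset_left (by simp)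

theorem map_PhiInv : lebesgue.map (fun x : Sample => PhiInv x) = gaussianReal 0 1 := by
  have := Measure.isProbabilityMeasure_map (μ := lebesgue) measurable_PhiInv.aemeasurable
  refine Measure.ext_of_Iic _ _ fun t => ?_
  rw [Measure.map_apply measurable_PhiInv measurableSet_Iic, ← ofReal_cdf]
  have h1 : lebesgue ((fun x : Sample => PhiInv x) ⁻¹' Iic t)
      = lebesgue ((↑) ⁻¹' Ioc (0 : ℝ) (Phi t)) := by
    refine measure_congr ?_
    filter_upwards [ae_pos] with x hx
    refine propext ?_
    change PhiInv x ≤ t ↔ 0 < (x : ℝ) ∧ (x : ℝ) ≤ Phi t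
    rw [PhiInv_le_iff hx x.2.2]
    exact ⟨fun h => ⟨hx, h⟩, fun h => h.2⟩
  rw [h1, lebesgue_apply]
  have hle : Phi t ≤ 1 := cdf_le_one _ _
  change volume (Ioc 0 (Phi t) ∩ Ico 0 1) = ENNReal.ofReal (Phi t)
  apply le_antisymm
  · exact (measure_mono inter_subset_left).trans (by simp)
  · refine le_trans (by simp) (measure_mono (μ := volume) (s := Ioo (0 : ℝ) (Phi t)) ?_)
    exact fun x hx => ⟨⟨hx.1, hx.2.le⟩, hx.1.le, lt_of_lt_of_le hx.2 hle⟩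

/-- `f_θ(x) = exp(-θ + √(2θ) Φ⁻¹(x))`. At the endpoint `x = 0`, where `Φ⁻¹(0) = -∞`, this reads
`e^{-∞} = 0` for `θ > 0`, and `f_0 = 1` everywhere. -/
def gaussianTilt (θ : ℝ) (x : Sample) : ℝ :=
  if (x : ℝ) = 0 then (if θ = 0 then 1 else 0)
  else Real.exp (-θ + √(2 * θ) * PhiInv x)

theorem measurable_gaussianTilt (θ : ℝ) : Measurable (gaussianTilt θ) := by
  unfold gaussianTilt
  refine Measurable.ite (measurable_subtype_coe (measurableSet_singleton _)) measurable_const ?_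
  exact Real.measurable_exp.comp ((measurable_PhiInv.const_mul _).const_add _)

theorem gaussianTilt_nonneg (θ : ℝ) (x : Sample) : 0 ≤ gaussianTilt θ x := by
  unfold gaussianTilt
  split_ifs <;> positivity

theorem gaussianTilt_ae : ∀ᵐ x : Sample ∂lebesgue, ∀ θ,
    gaussianTilt θ x = Real.exp (-θ + √(2 * θ) * PhiInv x) := by
  filter_upwards [ae_pos] with x hx θ
  simp [gaussianTilt, hx.ne']

theorem lintegral_gaussianTilt (θ : ℝ) (hθ : 0 ≤ θ) :
    ∫⁻ x, ENNReal.ofReal (gaussianTilt θ x) ∂lebesgue = 1 := by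
  have h1 : ∫⁻ x, ENNReal.ofReal (gaussianTilt θ x) ∂lebesgue
      = ∫⁻ x : Sample, ENNReal.ofReal (Real.exp (-θ + √(2 * θ) * PhiInv x)) ∂lebesgue := by
    refine lintegral_congr_ae ?_
    filter_upwards [gaussianTilt_ae] with x hx
    rw [hx]
  have hm : Measurable fun z : ℝ => ENNReal.ofReal (Real.exp (-θ + √(2 * θ) * z)) := by fun_prop
  rw [h1, ← lintegral_map hm measurable_PhiInv, map_PhiInv]
  have hint : Integrable (fun z : ℝ => Real.exp (√(2 * θ) * z)) (gaussianReal 0 1) :=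
    integrable_exp_mul_gaussianReal _
  have hmgf : ∫ z, Real.exp (√(2 * θ) * z) ∂(gaussianReal 0 1) = Real.exp θ := by
    have := congrFun (mgf_id_gaussianReal (μ := 0) (v := 1)) (√(2 * θ))
    simp only [mgf, id] at this
    rw [this, Real.sq_sqrt (by positivity)]
    congr 1
    simp
  simp only [Real.exp_add]
  rw [← ofReal_integral_eq_lintegral_ofReal (hint.const_mul _)
    (Eventually.of_forall fun z => by positivity), integral_const_mul, hmgf, ← Real.exp_add]
  simp

/-- The density `f_θ`, for `θ ∈ [0,1]`. -/
def fTheta (θ : I) : ProbDensity lebesgue where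
  toFun := gaussianTilt θ
  measurable_toFun := measurable_gaussianTilt θ
  nonneg := gaussianTilt_nonneg θ
  lintegral_eq_one := lintegral_gaussianTilt θ θ.2.1

/-- The `j`-th cell `[j/(2N²), (j+1)/(2N²))` of the partition `P_N` of `[0,1)`. -/
def cell (N : ℕ+) (j : Fin (2 * (N : ℕ) ^ 2)) : Set Sample :=
  (↑) ⁻¹' Set.Ico ((j : ℝ) / (2 * (N : ℝ) ^ 2)) (((j : ℝ) + 1) / (2 * (N : ℝ) ^ 2))

/-- The choices of exactly `N²` of the `2N²` cells of `P_N`. -/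
abbrev CellChoice (N : ℕ+) : Type :=
  {S : Finset (Fin (2 * (N : ℕ) ^ 2)) // S.card = (N : ℕ) ^ 2}

theorem measurableSet_cell (N : ℕ+) (j) : MeasurableSet (cell N j) :=
  measurable_subtype_coe measurableSet_Ico

theorem lebesgue_cell (N : ℕ+) (j) :
    lebesgue (cell N j) = ENNReal.ofReal (1 / (2 * (N : ℝ) ^ 2)) := by
  have hN : (0 : ℝ) < 2 * (N : ℝ) ^ 2 := by
    have : (0 : ℝ) < (N : ℝ) := by exact_mod_cast N.pos
    positivity
  have hj : (j : ℝ) + 1 ≤ 2 * (N : ℝ) ^ 2 := by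
    have := j.2
    exact_mod_cast this
  rw [cell, lebesgue_apply, inter_eq_left.mpr, Real.volume_Ico]
  · congr 1; ring
  · refine Ico_subset_Ico (by positivity) ?_
    rwa [div_le_one hN]

theorem disjoint_cell (N : ℕ+) {i j} (h : i ≠ j) : Disjoint (cell N i) (cell N j) := by
  have hN : (0 : ℝ) < 2 * (N : ℝ) ^ 2 := by
    have : (0 : ℝ) < (N : ℝ) := by exact_mod_cast N.pos
    positivity
  rw [Set.disjoint_left]
  rintro x ⟨h1, h2⟩ ⟨h3, h4⟩
  rw [div_le_iff₀ hN] at h1 h3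
  rw [lt_div_iff₀ hN] at h2 h4
  have h5 : (i : ℕ) < (j : ℕ) + 1 := by exact_mod_cast lt_of_le_of_lt h1 h4
  have h6 : (j : ℕ) < (i : ℕ) + 1 := by exact_mod_cast lt_of_le_of_lt h3 h2
  exact h (Fin.ext (by omega))

theorem lebesgue_iUnion_cell (N : ℕ+) (S : CellChoice N) :
    lebesgue (⋃ j ∈ S.1, cell N j) = 2⁻¹ := by
  rw [measure_biUnion_finset (fun i _ j _ h => disjoint_cell N h)
    (fun j _ => measurableSet_cell N j)]
  simp only [lebesgue_cell, Finset.sum_const, S.2]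
  have : (0 : ℝ) < (N : ℝ) := by exact_mod_cast N.pos
  rw [nsmul_eq_mul, ← ENNReal.ofReal_natCast, ← ENNReal.ofReal_mul (by positivity)]
  have h2 : (((N : ℕ) ^ 2 : ℕ) : ℝ) * (1 / (2 * (N : ℝ) ^ 2)) = 2⁻¹ := by
    push_cast
    field_simp
  rw [h2, ENNReal.ofReal_inv_of_pos (by norm_num)]
  simp

/-- The density equal to `2` on the chosen `N²` cells of `P_N` and to `0` on the others. -/
def step (N : ℕ+) (S : CellChoice N) : ProbDensity lebesgue where
  toFun := (⋃ j ∈ S.1, cell N j).indicator (fun _ => 2)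
  measurable_toFun := measurable_const.indicator
    (S.1.measurableSet_biUnion fun j _ => measurableSet_cell N j)
  nonneg := Set.indicator_nonneg fun _ _ => by norm_num
  lintegral_eq_one := by
    have hm : MeasurableSet (⋃ j ∈ S.1, cell N j) :=
      S.1.measurableSet_biUnion fun j _ => measurableSet_cell N j
    have : (fun x => ENNReal.ofReal ((⋃ j ∈ S.1, cell N j).indicator (fun _ => (2 : ℝ)) x))
        = (⋃ j ∈ S.1, cell N j).indicator (fun _ => (2 : ℝ≥0∞)) := by
      ext x
      by_cases hx : x ∈ ⋃ j ∈ S.1, cell N j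
      · simp only [Set.indicator_of_mem hx]; simp
      · simp only [Set.indicator_of_notMem hx]; simp
    rw [this, lintegral_indicator hm, setLIntegral_const, lebesgue_iUnion_cell]
    exact ENNReal.mul_inv_cancel (by norm_num) (by norm_num)

theorem step_injective (N : ℕ+) : Function.Injective (step N) := by
  have key : ∀ S T : CellChoice N, step N S = step N T → S.1 ⊆ T.1 := fun S T h j hj => by
    have hne : (cell N j).Nonempty := by
      refine nonempty_of_measure_ne_zero (μ := lebesgue) ?_
      have : (0 : ℝ) < (N : ℝ) := by exact_mod_cast N.pos
      rw [lebesgue_cell, Ne, ENNReal.ofReal_eq_zero, not_le]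
      positivity
    obtain ⟨x, hx⟩ := hne
    have h1 : (⋃ j ∈ S.1, cell N j).indicator (fun _ => (2 : ℝ)) x
        = (⋃ j ∈ T.1, cell N j).indicator (fun _ => (2 : ℝ)) x :=
      congrFun (congrArg ProbDensity.toFun h) x
    rw [Set.indicator_of_mem (Set.mem_iUnion₂.mpr ⟨j, hj, hx⟩)] at h1
    have h2 : x ∈ ⋃ j ∈ T.1, cell N j := by
      by_contra hn
      rw [Set.indicator_of_notMem hn] at h1
      norm_num at h1
    obtain ⟨i, hi, hxi⟩ := Set.mem_iUnion₂.mp h2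
    by_cases hij : i = j
    · exact hij ▸ hi
    · exact absurd hx (Set.disjoint_left.mp (disjoint_cell N hij) hxi)
  exact fun S T h => Subtype.ext ((key S T h).antisymm (key T S h.symm))

/-- `𝔽₀ = {f_θ : θ ∈ [0,1]}`. -/
def family₀ : Set (ProbDensity lebesgue) := Set.range fTheta

/-- `𝔽_N`. -/
def familyN (N : ℕ+) : Set (ProbDensity lebesgue) := Set.range (step N)

/-- `𝔽 = 𝔽₀ ∪ ⋃_N 𝔽_N`. -/
def family : Set (ProbDensity lebesgue) := family₀ ∪ ⋃ N : ℕ+, familyN N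

/-- `f_θ` as an element of `𝔽`. -/
def fThetaMem (θ : I) : family := ⟨fTheta θ, Or.inl ⟨θ, rfl⟩⟩

/-- The step densities as elements of `𝔽`. -/
def stepMem (N : ℕ+) (S : CellChoice N) : family :=
  ⟨step N S, Or.inr (Set.mem_iUnion.mpr ⟨N, S, rfl⟩)⟩

/-- The law on `[0,1]` with density proportional to `e^{-1/θ}`. -/
def thetaPrior : Measure I :=
  normalizedMeasure (volume.withDensity fun θ : I => ENNReal.ofReal (Real.exp (-1 / (θ : ℝ))))

/-- `Π₀`, the image on `𝔽` of the law of `θ`. -/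
def prior₀ : Measure family := thetaPrior.map fThetaMem

/-- `Π_△ ∝ ∑_N N⁻² ∑_{g ∈ 𝔽_N} (2N² choose N²)⁻¹ δ_g`; the members of `𝔽_N` are listed without
repetition by the choices of `N²` cells. -/
def priorStep : Measure family :=
  normalizedMeasure (Measure.sum fun N : ℕ+ => (((N : ℕ) : ℝ≥0∞) ^ 2)⁻¹ •
    ∑ S : CellChoice N,
      (((2 * (N : ℕ) ^ 2).choose ((N : ℕ) ^ 2) : ℕ) : ℝ≥0∞)⁻¹ • Measure.dirac (stepMem N S))

/-- Barron's prior `Π = ½ Π₀ + ½ Π_△`. -/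
def prior : Measure family := (2⁻¹ : ℝ≥0∞) • prior₀ + (2⁻¹ : ℝ≥0∞) • priorStep

/-- The true density: `f_0`, the uniform density on `[0,1)`. -/
def uniformDensity : ProbDensity lebesgue := fTheta 0

theorem uniformDensity_apply (x : Sample) : uniformDensity x = 1 := by
  simp [uniformDensity, fTheta, gaussianTilt]

/-! The prior is a probability measure. -/

theorem continuous_fTheta : Continuous fTheta := by
  rw [continuous_induced_rng, continuous_iff_continuousAt]
  intro θ₀
  rw [ContinuousAt, ProbabilityMeasure.tendsto_iff_forall_lintegral_tendsto]
  intro g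
  have hrw : ∀ θ : I, ∫⁻ x, (g x : ℝ≥0∞) ∂((fTheta θ).toMeasure : Measure Sample)
      = ∫⁻ x, ENNReal.ofReal (gaussianTilt θ x) * g x ∂lebesgue := fun θ => by
    change ∫⁻ x, (g x : ℝ≥0∞) ∂(lebesgue.withDensity
      (fun x => ENNReal.ofReal (gaussianTilt θ x))) = _
    rw [lintegral_withDensity_eq_lintegral_mul _ (measurable_gaussianTilt θ).ennreal_ofReal
      g.continuous.measurable.coe_nnreal_ennreal]
    rfl
  simp only [Function.comp_apply, hrw]
  obtain ⟨C, hC⟩ : ∃ C : ℝ≥0, ∀ x, g x ≤ C :=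
    ⟨nndist g 0, fun x => BoundedContinuousFunction.NNReal.upper_bound g x⟩
  have hdom : ∫⁻ x : Sample, ENNReal.ofReal (Real.exp (√2 * |PhiInv x|)) * C ∂lebesgue ≠ ∞ := by
    have hm : Measurable fun z : ℝ => ENNReal.ofReal (Real.exp (√2 * |z|)) := by fun_prop
    have hm' : Measurable fun x : Sample => ENNReal.ofReal (Real.exp (√2 * |PhiInv x|)) :=
      hm.comp measurable_PhiInv
    rw [lintegral_mul_const _ hm', ← lintegral_map hm measurable_PhiInv,
      map_PhiInv]
    refine ENNReal.mul_ne_top ?_ ENNReal.coe_ne_top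
    have hi : Integrable (fun z : ℝ => Real.exp (√2 * |z|)) (gaussianReal 0 1) :=
      integrable_exp_mul_abs (X := id) (integrable_exp_mul_gaussianReal _)
        (integrable_exp_mul_gaussianReal _)
    exact hi.lintegral_lt_top.ne
  refine tendsto_lintegral_filter_of_dominated_convergence _ ?_ ?_ hdom ?_
  · exact Eventually.of_forall fun θ => (measurable_gaussianTilt θ).ennreal_ofReal.mul
      g.continuous.measurable.coe_nnreal_ennreal
  · refine Eventually.of_forall fun θ => ?_
    filter_upwards [gaussianTilt_ae] with x hx
    rw [hx]
    gcongr
    · have h1 : √(2 * (θ : ℝ)) ≤ √2 := Real.sqrt_le_sqrt (by linarith [θ.2.2])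
      have h2 : √(2 * (θ : ℝ)) * PhiInv x ≤ √2 * |PhiInv x| :=
        (mul_le_mul_of_nonneg_left (le_abs_self _) (Real.sqrt_nonneg _)).trans
          (mul_le_mul_of_nonneg_right h1 (abs_nonneg _))
      linarith [θ.2.1]
    · exact hC x
  · filter_upwards [gaussianTilt_ae] with x hx
    simp only [hx]
    refine ENNReal.Tendsto.mul_const ?_ (Or.inr ENNReal.coe_ne_top)
    have hcont : Continuous fun θ : I =>
        ENNReal.ofReal (Real.exp (-(θ : ℝ) + √(2 * (θ : ℝ)) * PhiInv x)) :=
      ENNReal.continuous_ofReal.comp (by fun_prop)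
    exact hcont.tendsto θ₀

theorem measurable_fThetaMem : Measurable fThetaMem :=
  (Continuous.subtype_mk continuous_fTheta _).measurable

instance : IsProbabilityMeasure thetaPrior := by
  have hm : Measurable fun θ : I => ENNReal.ofReal (Real.exp (-1 / (θ : ℝ))) := by fun_prop
  apply isProbabilityMeasure_normalizedMeasure
  · rw [withDensity_apply _ MeasurableSet.univ, Measure.restrict_univ]
    intro h
    rw [lintegral_eq_zero_iff hm] at h
    have : ∀ᵐ _θ : I, False := by
      filter_upwards [h] with θ hθ
      simp only [Pi.zero_apply, ENNReal.ofReal_eq_zero] at hθ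
      exact absurd hθ (not_le.mpr (Real.exp_pos _))
    exact this.exists.elim fun _ hf => hf
  · rw [withDensity_apply _ MeasurableSet.univ, Measure.restrict_univ]
    refine ne_top_of_le_ne_top (b := ∫⁻ _θ : I, 1) (by simp) (lintegral_mono fun θ => ?_)
    rw [← ENNReal.ofReal_one]
    refine ENNReal.ofReal_le_ofReal (Real.exp_le_one_iff.mpr ?_)
    exact div_nonpos_of_nonpos_of_nonneg (by norm_num) θ.2.1

instance : IsProbabilityMeasure prior₀ :=
  Measure.isProbabilityMeasure_map measurable_fThetaMem.aemeasurable

theorem card_cellChoice (N : ℕ+) :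
    Fintype.card (CellChoice N) = (2 * (N : ℕ) ^ 2).choose ((N : ℕ) ^ 2) := by
  simp [CellChoice]

theorem summable_pnat_inv_sq : Summable fun N : ℕ+ => (((N : ℕ) : ℝ≥0) ^ 2)⁻¹ := by
  have hs : Summable fun n : ℕ => ((n : ℝ) ^ 2)⁻¹ :=
    Real.summable_nat_pow_inv.mpr (by norm_num)
  have hs' : Summable fun N : ℕ+ => (((N : ℕ) : ℝ) ^ 2)⁻¹ :=
    hs.comp_injective (i := fun N : ℕ+ => (N : ℕ)) PNat.coe_injective
  rw [← NNReal.summable_coe]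
  refine hs'.congr fun N => ?_
  push_cast
  rfl

instance : IsProbabilityMeasure priorStep := by
  have hN : ∀ N : ℕ+, ((((N : ℕ) : ℝ≥0∞) ^ 2)⁻¹ • ∑ S : CellChoice N,
      (((2 * (N : ℕ) ^ 2).choose ((N : ℕ) ^ 2) : ℕ) : ℝ≥0∞)⁻¹ •
        Measure.dirac (stepMem N S)) univ = (((N : ℕ) : ℝ≥0∞) ^ 2)⁻¹ := fun N => by
    have hpos : (2 * (N : ℕ) ^ 2).choose ((N : ℕ) ^ 2) ≠ 0 :=
      (Nat.choose_pos (by omega)).ne'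
    simp only [Measure.smul_apply, Measure.coe_finsetSum, Finset.sum_apply, measure_univ,
      smul_eq_mul, mul_one, Finset.sum_const, Finset.card_univ, card_cellChoice, nsmul_eq_mul]
    rw [ENNReal.mul_inv_cancel (by exact_mod_cast hpos) (ENNReal.natCast_ne_top _), mul_one]
  apply isProbabilityMeasure_normalizedMeasure
  · rw [Measure.sum_apply _ MeasurableSet.univ]
    simp only [hN]
    intro h
    have := ENNReal.tsum_eq_zero.mp h 1
    simp at this
  · rw [Measure.sum_apply _ MeasurableSet.univ]
    simp only [hN]
    have h1 : ∀ N : ℕ+, (((N : ℕ) : ℝ≥0∞) ^ 2)⁻¹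
        = (((((N : ℕ) : ℝ≥0) ^ 2)⁻¹ : ℝ≥0) : ℝ≥0∞) := fun N => by
      rw [ENNReal.coe_inv (pow_ne_zero 2 (by exact_mod_cast N.ne_zero)), ENNReal.coe_pow,
        ENNReal.coe_natCast]
    simp only [h1]
    exact ENNReal.tsum_coe_ne_top_iff_summable.mpr summable_pnat_inv_sq

instance : IsProbabilityMeasure prior := ⟨by
  rw [prior, Measure.add_apply, Measure.smul_apply, Measure.smul_apply, measure_univ, measure_univ]
  simp [ENNReal.inv_two_add_inv_two]⟩

end Barron

end

/-!
# Barron's counterexample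

A step density `f` has `R_n(f) ∈ {0, 2ⁿ}`, so the posterior mass of `{R_n = 2ⁿ}` is at least
`a / (a + b)`, where `a = ∫ R_n dΠ_△` and `b = ∫ R_n dΠ₀` are the step part and the smooth part of
the evidence (`le_posterior`). It suffices that `b / a → 0` almost surely.

*Step part.* Among the partitions, only the one with index `N = n` is needed. The first `n` data
points lie in at most `n` of its `2n²` cells. A uniformly random choice of half of the cells
contains all of these with probability at least `2⁻ⁿ / 2`: sampling without replacement differs from
independent fair coin tosses only by a constant factor when the number of cells is of order `n²`
(`choose_le_card_fitting`). The prior weight `n⁻²` gives `a ≥ c / n²` for every data sequence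
(`le_priorStep_fittingSteps`).

*Smooth part.* Here `R_n(f_θ) = exp(-nθ + √(2θ) S_n)` with `S_n = ∑ Φ⁻¹(X_i)` a sum of independent
standard normal variables, and almost surely `S_n ≤ n^{3/4}` for all large `n`
(`ae_eventually_sum_PhiInv_lt`). Then `√(2θ) S_n ≤ nθ/2 + √n`, while `1/θ + nθ/2 ≥ √(2n)`, so
`e^{-1/θ} R_n(f_θ) ≤ exp(-(√2 - 1)√n)` uniformly in `θ > 0` (`exponent_le`). Hence `b` decays faster
than any power of `n`.

So the posterior mass even converges to `1` almost surely.

Integrals against `Π_△` are evaluated on sets of step densities, which are measurable because a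
step density is the only member of the model with its probability measure
(`measurableSet_singleton_stepMem`). For the smooth part only an upper bound is required, which
needs no measurability of `R_n` on the model.
-/

/-! ### Counting the cell choices that contain given cells -/

/-- A random `m`-subset of a `2m`-set contains `k` given elements with probability at least
`2⁻ᵏ (1 - k² / (2m))`, hence at least `2⁻ᵏ / 2` as long as `k² ≤ m`. -/
theorem one_sub_mul_centralBinom_le {m k : ℕ} (hk : k ≤ m) :
    (1 - (k : ℝ) ^ 2 / (2 * m)) * ((2 * m).choose m : ℝ)
      ≤ 2 ^ k * ((2 * m - k).choose (m - k) : ℝ) := by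
  induction k with
  | zero => simp
  | succ k ih =>
    have ih := ih (by omega)
    obtain ⟨j, rfl⟩ : ∃ j, m = k + 1 + j := ⟨m - (k + 1), by omega⟩
    have e1 : 2 * (k + 1 + j) - k = k + 1 + 2 * j + 1 := by omega
    have e2 : k + 1 + j - k = j + 1 := by omega
    have e3 : 2 * (k + 1 + j) - (k + 1) = k + 1 + 2 * j := by omega
    have e4 : k + 1 + j - (k + 1) = j := by omega
    rw [e1, e2] at ih
    rw [e3, e4]
    have hrec : ((k : ℝ) + 1 + 2 * j + 1) * ((k + 1 + 2 * j).choose j : ℝ)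
        = ((k + 1 + 2 * j + 1).choose (j + 1) : ℝ) * (j + 1) := by
      exact_mod_cast Nat.add_one_mul_choose_eq (k + 1 + 2 * j) j
    set q : ℝ := ((k + 1 + 2 * j + 1).choose (j + 1) : ℝ)
    set q' : ℝ := ((k + 1 + 2 * j).choose j : ℝ)
    set C : ℝ := ((2 * (k + 1 + j)).choose (k + 1 + j) : ℝ)
    have hC : 0 ≤ C := Nat.cast_nonneg _
    have hq : 0 ≤ q := Nat.cast_nonneg _
    push_cast at ih ⊢
    set M : ℝ := (k : ℝ) + 1 + j with hM
    have hM0 : 0 < M := by positivity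
    have hj : (0 : ℝ) ≤ j := Nat.cast_nonneg _
    have hk0 : (0 : ℝ) ≤ k := Nat.cast_nonneg _
    -- the ratio of consecutive binomial coefficients, `(m - k) / (2m - k) ≥ (1 - k / m) / 2`
    have h1 : (1 - k / M) * q ≤ 2 * q' := by
      have : q' = q * (j + 1) / (k + 1 + 2 * j + 1) := by
        rw [eq_div_iff (by positivity)]; linarith
      have h2 : 1 - k / M ≤ 2 * (j + 1) / (k + 1 + 2 * j + 1) := by
        have e : 1 - k / M = (j + 1) / M := by field_simp; rw [hM]; ring
        rw [e, div_le_div_iff₀ hM0 (by positivity)]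
        rw [hM]; nlinarith
      calc (1 - k / M) * q ≤ 2 * (j + 1) / (k + 1 + 2 * j + 1) * q := by gcongr
        _ = 2 * q' := by rw [this]; ring
    have h3 : 0 ≤ 1 - k / M := by
      rw [sub_nonneg, div_le_one hM0]; rw [hM]; linarith
    calc (1 - ((k : ℝ) + 1) ^ 2 / (2 * M)) * C
        ≤ ((1 - (k : ℝ) ^ 2 / (2 * M)) * (1 - k / M)) * C := by
          gcongr
          have : (1 - (k : ℝ) ^ 2 / (2 * M)) * (1 - k / M) - (1 - ((k : ℝ) + 1) ^ 2 / (2 * M))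
              = 1 / (2 * M) + k ^ 2 / (2 * M) * (k / M) := by field_simp; ring
          have : 0 ≤ 1 / (2 * M) + k ^ 2 / (2 * M) * (k / M) := by positivity
          linarith
      _ = (1 - k / M) * ((1 - (k : ℝ) ^ 2 / (2 * M)) * C) := by ring
      _ ≤ (1 - k / M) * (2 ^ k * q) := by gcongr
      _ = 2 ^ k * ((1 - k / M) * q) := by ring
      _ ≤ 2 ^ k * (2 * q') := by gcongr
      _ = 2 ^ (k + 1) * q' := by ring

/-- The left side counts the sets `T ∪ J` with `T` disjoint from `J` and `|T| = m - |J|`. -/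
theorem Finset.choose_le_card_filter_superset {α : Type*} [Fintype α] [DecidableEq α]
    (J : Finset α) {m : ℕ} (hJ : J.card ≤ m) :
    (Fintype.card α - J.card).choose (m - J.card)
      ≤ (Finset.univ.filter fun S : {S : Finset α // S.card = m} => J ⊆ S.1).card := by
  rw [← Finset.card_compl, ← Finset.card_powersetCard]
  have hd : ∀ T ∈ Finset.powersetCard (m - J.card) Jᶜ, Disjoint T J := fun T hT =>
    Finset.disjoint_left.mpr fun a ha => by
      simpa using (Finset.mem_powersetCard.mp hT).1 ha
  rw [← Finset.card_image_of_injective _ Subtype.val_injective]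
  refine Finset.card_le_card_of_injOn (fun T => T ∪ J) (fun T hT => ?_) (fun T hT T' hT' h => ?_)
  · have hc : (T ∪ J).card = m := by
      rw [Finset.card_union_of_disjoint (hd T hT), (Finset.mem_powersetCard.mp hT).2]; omega
    simp [hc]
  · have h : T ∪ J = T' ∪ J := h
    have := congrArg (· \ J) h
    simpa [Finset.union_sdiff_cancel_right (hd T hT),
      Finset.union_sdiff_cancel_right (hd T' hT')] using this

namespace Barron

/-! ### Step densities are determined by their probability measures -/

theorem exists_mem_cell (N : ℕ+) (x : Sample) : ∃ j, x ∈ cell N j := by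
  have hN : (0 : ℝ) < 2 * (N : ℝ) ^ 2 := by
    have : (0 : ℝ) < (N : ℝ) := by exact_mod_cast N.pos
    positivity
  have h0 : 0 ≤ (x : ℝ) * (2 * (N : ℝ) ^ 2) := mul_nonneg x.2.1 hN.le
  refine ⟨⟨⌊(x : ℝ) * (2 * (N : ℝ) ^ 2)⌋₊, ?_⟩, ?_, ?_⟩
  · rw [Nat.floor_lt h0]
    push_cast
    nlinarith [x.2.2]
  · rw [div_le_iff₀ hN]
    exact Nat.floor_le h0
  · rw [lt_div_iff₀ hN]
    exact Nat.lt_floor_add_one _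

theorem step_apply_of_mem_cell {N : ℕ+} {S : CellChoice N} {x : Sample} {j}
    (hx : x ∈ cell N j) : step N S x = if j ∈ S.1 then 2 else 0 := by
  change (⋃ j ∈ S.1, cell N j).indicator (fun _ => (2 : ℝ)) x = _
  split_ifs with h
  · exact indicator_of_mem (mem_iUnion₂.mpr ⟨j, h, hx⟩) _
  · refine indicator_of_notMem (fun hmem => ?_) _
    obtain ⟨i, hi, hxi⟩ := mem_iUnion₂.mp hmem
    have hij : i ≠ j := fun e => h (e ▸ hi)
    exact disjoint_left.mp (disjoint_cell N hij) hxi hx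

theorem step_eq_zero_or_two (N : ℕ+) (S : CellChoice N) (x : Sample) :
    step N S x = 0 ∨ step N S x = 2 := by
  obtain ⟨j, hj⟩ := exists_mem_cell N x
  rw [step_apply_of_mem_cell hj]
  split_ifs <;> simp

/-- A step density is constant to the right of each point, so it is determined everywhere by its
values almost everywhere. -/
theorem step_right_constant (N : ℕ+) (S : CellChoice N) (x : Sample) :
    ∃ b : ℝ, (x : ℝ) < b ∧ ∀ y : Sample, (x : ℝ) ≤ y → (y : ℝ) < b →
      step N S y = step N S x := by
  obtain ⟨j, hj⟩ := exists_mem_cell N x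
  refine ⟨_, hj.2, fun y hxy hy => ?_⟩
  rw [step_apply_of_mem_cell hj, step_apply_of_mem_cell (j := j) ⟨hj.1.trans hxy, hy⟩]

theorem lebesgue_Ico_pos (x : Sample) {b : ℝ} (hb : (x : ℝ) < b) :
    0 < lebesgue ((↑) ⁻¹' Ico (x : ℝ) b) := by
  rw [lebesgue_apply, Ico_inter_Ico, Real.volume_Ico, ENNReal.ofReal_pos, sub_pos]
  simp only [lt_inf_iff, sup_lt_iff]
  have := x.2.1
  have := x.2.2
  exact ⟨⟨hb, by linarith⟩, this, zero_lt_one⟩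

theorem toMeasure_eq_iff_ae_eq (f g : ProbDensity lebesgue) :
    f.toMeasure = g.toMeasure ↔ f.toFun =ᵐ[lebesgue] g.toFun := by
  refine Subtype.ext_iff.trans ?_
  change lebesgue.withDensity (fun x => ENNReal.ofReal (f x))
    = lebesgue.withDensity (fun x => ENNReal.ofReal (g x)) ↔ _
  rw [withDensity_eq_iff f.measurable_toFun.ennreal_ofReal.aemeasurable
    g.measurable_toFun.ennreal_ofReal.aemeasurable (by simp [f.lintegral_eq_one])]
  refine eventually_congr (Eventually.of_forall fun x => ?_)
  exact ENNReal.ofReal_eq_ofReal_iff (f.nonneg x) (g.nonneg x)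

theorem step_eq_of_toMeasure_eq {N N' : ℕ+} {S : CellChoice N} {S' : CellChoice N'}
    (h : (step N S).toMeasure = (step N' S').toMeasure) : step N S = step N' S' := by
  rw [toMeasure_eq_iff_ae_eq] at h
  have key : (step N S).toFun = (step N' S').toFun := by
    ext x
    obtain ⟨b, hb, hc⟩ := step_right_constant N S x
    obtain ⟨b', hb', hc'⟩ := step_right_constant N' S' x
    have hpos := lebesgue_Ico_pos x (lt_min hb hb')
    obtain ⟨y, hy, hyy⟩ : ∃ y : Sample, (y : ℝ) ∈ Ico (x : ℝ) (min b b') ∧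
        step N S y = step N' S' y := by
      by_contra! hne
      exact hpos.ne' (measure_mono_null (fun y hy => hne y hy) h)
    rw [← hc y hy.1 (hy.2.trans_le (min_le_left _ _)),
      ← hc' y hy.1 (hy.2.trans_le (min_le_right _ _))]
    exact hyy
  cases hs : step N S
  cases hs' : step N' S'
  rw [hs, hs'] at key
  simpa using key

theorem fTheta_toMeasure_ne_step (θ : I) (N : ℕ+) (S : CellChoice N) :
    (fTheta θ).toMeasure ≠ (step N S).toMeasure := by
  intro h
  rw [toMeasure_eq_iff_ae_eq] at h
  have hS : ∀ᵐ x ∂lebesgue, x ∈ ⋃ j ∈ S.1, cell N j := by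
    filter_upwards [h, gaussianTilt_ae] with x hx hx'
    by_contra hn
    have hz : step N S x = 0 := indicator_of_notMem hn (fun _ => (2 : ℝ))
    have h0 : gaussianTilt θ x = 0 := hx.trans hz
    rw [hx'] at h0
    exact (Real.exp_pos _).ne' h0
  have h1 : lebesgue (⋃ j ∈ S.1, cell N j) = 1 := by
    rw [measure_eq_measure_of_null_sdiff (subset_univ _) ?_, measure_univ]
    rw [← compl_eq_univ_sdiff]
    exact hS
  rw [lebesgue_iUnion_cell] at h1
  norm_num [ENNReal.inv_eq_one] at h1

theorem measurableSet_singleton_stepMem (N : ℕ+) (S : CellChoice N) :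
    MeasurableSet ({stepMem N S} : Set family) := by
  have hcont' : Continuous (ProbDensity.toMeasure : ProbDensity lebesgue → _) :=
    continuous_induced_dom
  have hcont : Continuous fun f : family => f.1.toMeasure := hcont'.comp continuous_subtype_val
  have heq : ({stepMem N S} : Set family)
      = (fun f : family => f.1.toMeasure) ⁻¹' {(step N S).toMeasure} := by
    ext f
    rw [mem_singleton_iff, mem_preimage, mem_singleton_iff, Subtype.ext_iff]
    change f.1 = step N S ↔ _
    refine ⟨fun h => by rw [h], fun h => ?_⟩
    rcases f.2 with ⟨θ, hθ⟩ | hf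
    · rw [← hθ] at h
      exact absurd h (fTheta_toMeasure_ne_step θ N S)
    · obtain ⟨N', S', hS'⟩ := mem_iUnion.mp hf
      rw [← hS'] at h ⊢
      exact step_eq_of_toMeasure_eq h
  rw [heq]
  exact (isClosed_singleton.preimage hcont).measurableSet

/-- The step densities, as a subset of the model. -/
def stepSet : Set family := range fun p : Σ N : ℕ+, CellChoice N => stepMem p.1 p.2

/-- Sets of step densities are countable unions of measurable singletons. -/
theorem measurableSet_of_subset_stepSet {T : Set family} (hT : T ⊆ stepSet) :
    MeasurableSet T := by
  have hc : T.Countable := (countable_range _).mono hT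
  rw [← biUnion_of_singleton T]
  refine MeasurableSet.biUnion hc fun f hf => ?_
  obtain ⟨p, rfl⟩ := hT hf
  exact measurableSet_singleton_stepMem p.1 p.2

end Barron

namespace Barron

/-! ### The data under the uniform density -/

theorem toMeasure_uniformDensity : (uniformDensity.toMeasure : Measure Sample) = lebesgue := by
  change lebesgue.withDensity (fun x => ENNReal.ofReal (uniformDensity x)) = lebesgue
  simp [uniformDensity_apply]

instance : IsProbabilityMeasure (iidLaw uniformDensity) := by
  unfold iidLaw; infer_instance

theorem iidLaw_map_eval (i : ℕ) :
    (iidLaw uniformDensity).map (fun x => x i) = lebesgue := by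
  rw [iidLaw]
  refine Eq.trans ?_ toMeasure_uniformDensity
  exact Measure.infinitePi_map_eval (fun _ : ℕ => (uniformDensity.toMeasure : Measure Sample)) i

theorem ae_forall_pos : ∀ᵐ x ∂(iidLaw uniformDensity), ∀ i, 0 < (x i : ℝ) := by
  rw [ae_all_iff]
  intro i
  have h := ae_pos
  rw [← iidLaw_map_eval i] at h
  exact ae_of_ae_map (measurable_pi_apply i).aemeasurable h

theorem hasSubgaussianMGF_PhiInv (i : ℕ) :
    HasSubgaussianMGF (fun x : ℕ → Sample => PhiInv (x i)) 1 (iidLaw uniformDensity) := by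
  have hmap : (iidLaw uniformDensity).map (fun x : ℕ → Sample => PhiInv (x i))
      = gaussianReal 0 1 := by
    have h := Measure.map_map (μ := iidLaw uniformDensity) measurable_PhiInv
      (measurable_pi_apply i)
    rw [iidLaw_map_eval i, map_PhiInv] at h
    exact h.symm
  have hm : Measurable fun x : ℕ → Sample => PhiInv (x i) :=
    measurable_PhiInv.comp (measurable_pi_apply i)
  refine ⟨fun t => ?_, fun t => ?_⟩
  · have h : Integrable (fun z => Real.exp (t * z)) (gaussianReal 0 1) :=
      integrable_exp_mul_gaussianReal t
    rw [← hmap] at h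
    exact h.comp_measurable hm
  · rw [mgf_gaussianReal hmap]
    simp

/-- A Gaussian tail bound and the Borel–Cantelli lemma: the quantile sums are `O(n^{3/4})`. -/
theorem ae_eventually_sum_PhiInv_lt : ∀ᵐ x ∂(iidLaw uniformDensity), ∀ᶠ n : ℕ in atTop,
    ∑ i ∈ Finset.range n, PhiInv (x i) < √n * √(√n) := by
  have hind : iIndepFun (fun (i : ℕ) (x : ℕ → Sample) => PhiInv (x i)) (iidLaw uniformDensity) :=
    iIndepFun_infinitePi (fun _ => measurable_PhiInv)
  have hbound : ∀ n : ℕ, (iidLaw uniformDensity).real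
      {x | √n * √(√n) ≤ ∑ i ∈ Finset.range n, PhiInv (x i)} ≤ Real.exp (-(1 / 2) * √n) := by
    intro n
    refine (HasSubgaussianMGF.measure_sum_range_ge_le_of_iIndepFun hind
      (fun i _ => hasSubgaussianMGF_PhiInv i) (by positivity)).trans_eq ?_
    congr 1
    rw [mul_pow, Real.sq_sqrt (by positivity), Real.sq_sqrt (by positivity)]
    rcases eq_or_ne n 0 with rfl | hn
    · simp
    · have : (n : ℝ) ≠ 0 := by exact_mod_cast hn
      simp only [NNReal.coe_one]
      field_simp
  have hsum : Summable fun n : ℕ => Real.exp (-(1 / 2) * √n) := by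
    refine summable_of_isBigO_nat (Real.summable_nat_pow_inv (p := 2) |>.mpr one_lt_two) ?_
    have h := (isLittleO_exp_neg_mul_rpow_atTop (a := 1 / 2) (by norm_num)
      (-4)).isBigO.comp_tendsto (Real.tendsto_sqrt_atTop.comp tendsto_natCast_atTop_atTop)
    refine h.congr_right fun n => ?_
    simp only [Function.comp_apply]
    rw [Real.rpow_neg (Real.sqrt_nonneg _)]
    rw [show (4 : ℝ) = ((2 * 2 : ℕ) : ℝ) by norm_num, Real.rpow_natCast, pow_mul,
      Real.sq_sqrt (by positivity)]
  have hfin : ∑' n : ℕ, (iidLaw uniformDensity)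
      {x | √n * √(√n) ≤ ∑ i ∈ Finset.range n, PhiInv (x i)} ≠ ∞ := by
    refine ne_top_of_le_ne_top hsum.tsum_ofReal_ne_top (ENNReal.tsum_le_tsum fun n => ?_)
    rw [← ofReal_measureReal]
    exact ENNReal.ofReal_le_ofReal (hbound n)
  filter_upwards [ae_eventually_notMem hfin] with x hx
  filter_upwards [hx] with n hn
  exact not_le.mp hn

/-! ### The smooth part of the evidence -/

theorem likelihoodRatio_fTheta {x : ℕ → Sample} (hx : ∀ i, 0 < (x i : ℝ)) (n : ℕ) (θ : I) :
    likelihoodRatio uniformDensity x n (fTheta θ)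
      = Real.exp (-(n * θ) + √(2 * θ) * ∑ i ∈ Finset.range n, PhiInv (x i)) := by
  have h : ∀ i, fTheta θ (x i) / uniformDensity (x i)
      = Real.exp (-θ + √(2 * θ) * PhiInv (x i)) := fun i => by
    rw [uniformDensity_apply, div_one]
    simp [fTheta, gaussianTilt, (hx i).ne']
  simp only [likelihoodRatio, h]
  rw [← Real.exp_sum]
  simp [Finset.sum_add_distrib, Finset.mul_sum]

/-- Since `1/θ + nθ/2 ≥ √(2n)`, the prior weight `e^{-1/θ}` makes the integrand of the smooth
part at most `exp(-(√2 - 1)√n)` as soon as the quantile sum `s` is at most `n^{3/4}`. -/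
theorem exponent_le {n : ℕ} (hn : 0 < n) {θ s : ℝ} (hθ : 0 < θ) (hs : s ≤ √n * √(√n)) :
    -1 / θ + (-(n * θ) + √(2 * θ) * s) ≤ -(√2 - 1) * √n := by
  have hn' : (0 : ℝ) < n := by exact_mod_cast hn
  obtain ⟨r, hr, hrn⟩ : ∃ r : ℝ, 0 < r ∧ (n : ℝ) = r ^ 4 :=
    ⟨√(√n), by positivity, by
      rw [show 4 = 2 * 2 by rfl, pow_mul, Real.sq_sqrt (by positivity), Real.sq_sqrt hn'.le]⟩
  obtain ⟨t, ht, htt⟩ : ∃ t : ℝ, 0 < t ∧ θ = t ^ 2 := ⟨√θ, by positivity, by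
    rw [Real.sq_sqrt hθ.le]⟩
  have e1 : √(n : ℝ) = r ^ 2 := by
    rw [hrn, show r ^ 4 = (r ^ 2) ^ 2 by ring, Real.sqrt_sq (by positivity)]
  have e2 : √(√(n : ℝ)) = r := by rw [e1, Real.sqrt_sq hr.le]
  have e3 : √(2 * θ) = √2 * t := by
    rw [htt, Real.sqrt_mul (by norm_num), Real.sqrt_sq ht.le]
  have h2 : √2 ^ 2 = 2 := Real.sq_sqrt (by norm_num)
  have h2p : 0 < √2 := by positivity
  rw [e3, e1]
  rw [e2, e1] at hs
  rw [htt, hrn]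
  have ha : √2 * t * s ≤ √2 * t * (r ^ 2 * r) := by gcongr
  -- `√(2θ) n^{3/4} ≤ nθ/2 + √n`
  have hb : √2 * t * (r ^ 2 * r) ≤ r ^ 4 * t ^ 2 / 2 + r ^ 2 := by
    have : r ^ 4 * t ^ 2 / 2 + r ^ 2 - √2 * t * (r ^ 2 * r)
        = r ^ 2 * (√2 * (r * t) / 2 - 1) ^ 2 := by
      linear_combination (-(r ^ 4 * t ^ 2 / 4)) * h2
    have : 0 ≤ r ^ 2 * (√2 * (r * t) / 2 - 1) ^ 2 := by positivity
    linarith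
  -- `√(2n) ≤ 1/θ + nθ/2`
  have hc : √2 * r ^ 2 ≤ 1 / t ^ 2 + r ^ 4 * t ^ 2 / 2 := by
    have : 1 / t ^ 2 + r ^ 4 * t ^ 2 / 2 - √2 * r ^ 2 = (1 / t - √2 * r ^ 2 * t / 2) ^ 2 := by
      field_simp
      linear_combination (-(r ^ 4 * t ^ 4)) * h2
    nlinarith [sq_nonneg (1 / t - √2 * r ^ 2 * t / 2)]
  have hd : -1 / t ^ 2 = -(1 / t ^ 2) := by ring
  rw [hd]
  linarith

/-- The mass of the unnormalized prior `e^{-1/θ} dθ`. -/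
noncomputable def thetaMass : ℝ≥0∞ :=
  (volume.withDensity fun θ : I => ENNReal.ofReal (Real.exp (-1 / (θ : ℝ)))) univ

theorem thetaMass_ne_zero : thetaMass ≠ 0 := by
  intro h
  have h1 : thetaPrior univ = 1 := measure_univ
  rw [thetaPrior, normalizedMeasure, Measure.smul_apply, smul_eq_mul] at h1
  change thetaMass⁻¹ * thetaMass = 1 at h1
  rw [h, mul_zero] at h1
  exact zero_ne_one h1

theorem lintegral_likelihoodRatio_prior₀_le {x : ℕ → Sample} (hx : ∀ i, 0 < (x i : ℝ)) {n : ℕ}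
    (hn : 0 < n) (hs : ∑ i ∈ Finset.range n, PhiInv (x i) ≤ √n * √(√n)) :
    ∫⁻ g : family, ENNReal.ofReal (likelihoodRatio uniformDensity x n g) ∂prior₀
      ≤ thetaMass⁻¹ * ENNReal.ofReal (Real.exp (-(√2 - 1) * √n)) := by
  rw [prior₀]
  refine (lintegral_map_le _ _).trans ?_
  rw [thetaPrior, normalizedMeasure, lintegral_smul_measure, smul_eq_mul]
  change thetaMass⁻¹ * _ ≤ _
  gcongr
  have hmeas : Measurable fun θ : I => ENNReal.ofReal (Real.exp (-1 / (θ : ℝ))) := by fun_prop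
  have hrw : ∀ θ : I, likelihoodRatio uniformDensity x n (fThetaMem θ)
      = Real.exp (-(n * θ) + √(2 * θ) * ∑ i ∈ Finset.range n, PhiInv (x i)) :=
    likelihoodRatio_fTheta hx n
  simp only [hrw]
  rw [lintegral_withDensity_eq_lintegral_mul _ hmeas (by fun_prop)]
  -- at `θ = 0` the weight `Real.exp (-1 / θ)` takes the junk value `1`
  have h0 : ∀ᵐ θ : I, θ ≠ 0 := by
    rw [ae_iff]; simp
  calc _ ≤ ∫⁻ _θ : I, ENNReal.ofReal (Real.exp (-(√2 - 1) * √n)) := by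
        refine lintegral_mono_ae ?_
        filter_upwards [h0] with θ hθ
        rw [Pi.mul_apply, ← ENNReal.ofReal_mul (Real.exp_pos _).le, ← Real.exp_add]
        refine ENNReal.ofReal_le_ofReal (Real.exp_le_exp.mpr (exponent_le hn ?_ hs))
        exact lt_of_le_of_ne θ.2.1 fun h => hθ (Subtype.ext h.symm)
    _ = _ := by simp

end Barron

namespace Barron

/-! ### The step part of the evidence -/

/-- The unnormalized prior on the step densities. -/
noncomputable def stepWeight : Measure family :=
  Measure.sum fun N : ℕ+ => (((N : ℕ) : ℝ≥0∞) ^ 2)⁻¹ •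
    ∑ S : CellChoice N,
      (((2 * (N : ℕ) ^ 2).choose ((N : ℕ) ^ 2) : ℕ) : ℝ≥0∞)⁻¹ • Measure.dirac (stepMem N S)

theorem priorStep_eq : priorStep = (stepWeight univ)⁻¹ • stepWeight := rfl

theorem stepWeight_univ_ne : stepWeight univ ≠ 0 ∧ stepWeight univ ≠ ∞ := by
  have h : priorStep univ = 1 := measure_univ
  rw [priorStep_eq, Measure.smul_apply, smul_eq_mul] at h
  constructor <;> intro h0 <;> simp [h0] at h

theorem ae_mem_stepSet : ∀ᵐ f ∂priorStep, f ∈ stepSet := by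
  have hm : MeasurableSet stepSetᶜ := (measurableSet_of_subset_stepSet subset_rfl).compl
  change priorStep stepSetᶜ = 0
  rw [priorStep_eq, Measure.smul_apply, stepWeight, Measure.sum_apply _ hm]
  have h : ∀ (N : ℕ+) (S : CellChoice N), stepMem N S ∈ stepSet := fun N S => ⟨⟨N, S⟩, rfl⟩
  simp [Measure.dirac_apply' _ hm, h]

/-- The step densities whose support contains the first `n` data points. -/
def fittingSteps (x : ℕ → Sample) (n : ℕ) : Set family :=
  stepSet ∩ {f | likelihoodRatio uniformDensity x n f = 2 ^ n}

theorem measurableSet_fittingSteps (x : ℕ → Sample) (n : ℕ) :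
    MeasurableSet (fittingSteps x n) :=
  measurableSet_of_subset_stepSet inter_subset_left

theorem likelihoodRatio_step_eq (x : ℕ → Sample) (n : ℕ) (N : ℕ+) (S : CellChoice N) :
    likelihoodRatio uniformDensity x n (step N S) = 0 ∨
      likelihoodRatio uniformDensity x n (step N S) = 2 ^ n := by
  by_cases h : ∃ i ∈ Finset.range n, step N S (x i) = 0
  · obtain ⟨i, hi, h0⟩ := h
    exact Or.inl (Finset.prod_eq_zero hi (by rw [h0, zero_div]))
  · push Not at h
    right
    rw [likelihoodRatio, Finset.prod_congr rfl (g := fun _ => (2 : ℝ)), Finset.prod_const,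
      Finset.card_range]
    intro i hi
    rw [uniformDensity_apply, div_one]
    exact (step_eq_zero_or_two N S (x i)).resolve_left (h i hi)

theorem lintegral_likelihoodRatio_priorStep (x : ℕ → Sample) (n : ℕ) :
    ∫⁻ g : family, ENNReal.ofReal (likelihoodRatio uniformDensity x n g) ∂priorStep
      = 2 ^ n * priorStep (fittingSteps x n) := by
  rw [← lintegral_indicator_const (measurableSet_fittingSteps x n)]
  refine lintegral_congr_ae ?_
  filter_upwards [ae_mem_stepSet] with g hg
  obtain ⟨⟨N, S⟩, rfl⟩ := id hg
  by_cases h : stepMem N S ∈ fittingSteps x n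
  · rw [indicator_of_mem h, h.2]
    simp
  · rw [indicator_of_notMem h]
    rcases likelihoodRatio_step_eq x n N S with h0 | h0
    · change ENNReal.ofReal (likelihoodRatio uniformDensity x n (step N S)) = 0
      rw [h0, ENNReal.ofReal_zero]
    · exact absurd ⟨hg, h0⟩ h

/-- The first `n` data points occupy at most `n` of the `2n²` cells of the partition with index
`n`, so a fraction at least `2⁻ⁿ / 2` of the corresponding step densities fits them. -/
theorem choose_le_card_fitting (x : ℕ → Sample) (N : ℕ+) :
    (2 * (N : ℕ) ^ 2).choose ((N : ℕ) ^ 2) ≤ 2 * (2 ^ (N : ℕ) *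
      (Finset.univ.filter fun S : CellChoice N =>
        likelihoodRatio uniformDensity x N (step N S) = 2 ^ (N : ℕ)).card) := by
  choose c hc using exists_mem_cell N
  set J : Finset (Fin (2 * (N : ℕ) ^ 2)) :=
    (Finset.range N).image fun i => c (x i)
  have hJ : J.card ≤ N := Finset.card_image_le.trans_eq (Finset.card_range _)
  have hNN : (N : ℕ) ≤ (N : ℕ) ^ 2 := Nat.le_self_pow two_ne_zero _
  have hsub : (Finset.univ.filter fun S : CellChoice N => J ⊆ S.1)
      ⊆ Finset.univ.filter fun S : CellChoice N =>
        likelihoodRatio uniformDensity x N (step N S) = 2 ^ (N : ℕ) := by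
    intro S hS
    simp only [Finset.mem_filter, Finset.mem_univ, true_and] at hS ⊢
    rw [likelihoodRatio, Finset.prod_congr rfl (g := fun _ => (2 : ℝ)), Finset.prod_const,
      Finset.card_range]
    intro i hi
    rw [uniformDensity_apply, div_one, step_apply_of_mem_cell (hc (x i)),
      if_pos (hS (Finset.mem_image_of_mem _ hi))]
  have h1 := Finset.choose_le_card_filter_superset J (hJ.trans hNN)
  rw [Fintype.card_fin] at h1
  have h2 := h1.trans (Finset.card_le_card hsub)
  have h3 := one_sub_mul_centralBinom_le (hJ.trans hNN)
  have hN0 : (0 : ℝ) < (N : ℕ) := by exact_mod_cast N.pos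
  have hJ' : (J.card : ℝ) ≤ (N : ℕ) := by exact_mod_cast hJ
  have h4 : (2 : ℝ)⁻¹ ≤ 1 - (J.card : ℝ) ^ 2 / (2 * (((N : ℕ) ^ 2 : ℕ) : ℝ)) := by
    have : (J.card : ℝ) ^ 2 / (2 * (((N : ℕ) ^ 2 : ℕ) : ℝ)) ≤ 2⁻¹ := by
      rw [div_le_iff₀ (by positivity)]
      push_cast
      nlinarith [Nat.cast_nonneg (α := ℝ) J.card]
    linarith
  set F : ℕ := (Finset.univ.filter fun S : CellChoice N =>
        likelihoodRatio uniformDensity x N (step N S) = 2 ^ (N : ℕ)).card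
  have h5 : (2 : ℝ)⁻¹ * ((2 * (N : ℕ) ^ 2).choose ((N : ℕ) ^ 2) : ℝ) ≤ 2 ^ (N : ℕ) * (F : ℝ) :=
    calc _ ≤ _ := mul_le_mul_of_nonneg_right h4 (Nat.cast_nonneg _)
      _ ≤ _ := h3
      _ ≤ 2 ^ (N : ℕ) * (F : ℝ) := by
        gcongr
        norm_num
  have h6 : ((2 * (N : ℕ) ^ 2).choose ((N : ℕ) ^ 2) : ℝ) ≤ 2 * (2 ^ (N : ℕ) * (F : ℝ)) := by
    linarith
  exact_mod_cast h6

/-- The step part of the evidence is at least of order `n⁻²`, whatever the data. -/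
theorem le_priorStep_fittingSteps (x : ℕ → Sample) {n : ℕ} (hn : 0 < n) :
    (stepWeight univ)⁻¹ * ((n : ℝ≥0∞) ^ 2)⁻¹ * 2⁻¹ ≤ 2 ^ n * priorStep (fittingSteps x n) := by
  lift n to ℕ+ using hn with N
  set C := (2 * (N : ℕ) ^ 2).choose ((N : ℕ) ^ 2) with hC
  have hC0 : (C : ℝ≥0∞) ≠ 0 := by
    exact_mod_cast (Nat.choose_pos (by omega)).ne'
  set G := Finset.univ.filter fun S : CellChoice N =>
        likelihoodRatio uniformDensity x N (step N S) = 2 ^ (N : ℕ) with hG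
  have hcard : (C : ℝ≥0∞) ≤ 2 * (2 ^ (N : ℕ) * (G.card : ℝ≥0∞)) := by
    have h : C ≤ 2 * (2 ^ (N : ℕ) * G.card) := choose_le_card_fitting x N
    exact_mod_cast h
  have hsum : (G.card : ℝ≥0∞) ≤
      ∑ S : CellChoice N, Measure.dirac (stepMem N S) (fittingSteps x N) := by
    rw [Finset.card_eq_sum_ones, Nat.cast_sum]
    refine (Finset.sum_le_sum fun S hS => ?_).trans
      (Finset.sum_le_sum_of_subset (Finset.subset_univ G))
    have hmem : stepMem N S ∈ fittingSteps x N :=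
      ⟨⟨⟨N, S⟩, rfl⟩, (Finset.mem_filter.mp hS).2⟩
    rw [Measure.dirac_apply_of_mem hmem, Nat.cast_one]
  have hw : (((N : ℕ) : ℝ≥0∞) ^ 2)⁻¹ * ((C : ℝ≥0∞)⁻¹ * G.card)
      ≤ stepWeight (fittingSteps x N) := by
    refine le_trans ?_ (Measure.le_sum_apply _ _)
    refine le_trans ?_ (ENNReal.le_tsum N)
    simp only [Measure.smul_apply, Measure.coe_finsetSum, Finset.sum_apply, smul_eq_mul,
      ← Finset.mul_sum]
    gcongr
  have hhalf : (2⁻¹ : ℝ≥0∞) ≤ 2 ^ (N : ℕ) * ((C : ℝ≥0∞)⁻¹ * G.card) := by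
    calc (2⁻¹ : ℝ≥0∞) = 2⁻¹ * ((C : ℝ≥0∞)⁻¹ * C) := by
          rw [ENNReal.inv_mul_cancel hC0 (ENNReal.natCast_ne_top _), mul_one]
      _ ≤ 2⁻¹ * ((C : ℝ≥0∞)⁻¹ * (2 * (2 ^ (N : ℕ) * (G.card : ℝ≥0∞)))) := by gcongr
      _ = (2⁻¹ * 2) * (2 ^ (N : ℕ) * ((C : ℝ≥0∞)⁻¹ * G.card)) := by ring
      _ = _ := by rw [ENNReal.inv_mul_cancel two_ne_zero ENNReal.ofNat_ne_top, one_mul]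
  rw [priorStep_eq, Measure.smul_apply, smul_eq_mul]
  calc _ ≤ (stepWeight univ)⁻¹ * (((N : ℕ) : ℝ≥0∞) ^ 2)⁻¹ *
        (2 ^ (N : ℕ) * ((C : ℝ≥0∞)⁻¹ * G.card)) := by gcongr
    _ = 2 ^ (N : ℕ) * ((stepWeight univ)⁻¹ *
        ((((N : ℕ) : ℝ≥0∞) ^ 2)⁻¹ * ((C : ℝ≥0∞)⁻¹ * G.card))) := by ring
    _ ≤ _ := by gcongr

/-! ### The posterior -/

theorem posterior_le_one (x : ℕ → Sample) (n : ℕ) (A : Set family) :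
    posterior prior uniformDensity x n A ≤ 1 := by
  refine (measure_mono (subset_univ A)).trans ?_
  rw [_root_.posterior, Measure.smul_apply, withDensity_apply _ MeasurableSet.univ,
    Measure.restrict_univ, smul_eq_mul]
  exact ENNReal.inv_mul_le_one _

/-- The posterior mass of the fitting densities is at least `a / (a + b)`, where `a` and `b` are
the step part and the smooth part of the evidence. -/
theorem le_posterior (x : ℕ → Sample) (n : ℕ) :
    (2 ^ n * priorStep (fittingSteps x n) +
        ∫⁻ g : family, ENNReal.ofReal (likelihoodRatio uniformDensity x n g) ∂prior₀)⁻¹ *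
      (2 ^ n * priorStep (fittingSteps x n))
      ≤ posterior prior uniformDensity x n
        {f : family | likelihoodRatio uniformDensity x n f = Real.exp (Real.log 2 * n)} := by
  set a := 2 ^ n * priorStep (fittingSteps x n) with ha
  set b := ∫⁻ g : family, ENNReal.ofReal (likelihoodRatio uniformDensity x n g) ∂prior₀
  have hexp : Real.exp (Real.log 2 * n) = 2 ^ n := by
    rw [mul_comm, Real.exp_nat_mul, Real.exp_log two_pos]
  have hD : ∫⁻ g : family, ENNReal.ofReal (likelihoodRatio uniformDensity x n g) ∂prior
      = 2⁻¹ * (a + b) := by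
    rw [prior, lintegral_add_measure, lintegral_smul_measure, lintegral_smul_measure,
      lintegral_likelihoodRatio_priorStep, smul_eq_mul, smul_eq_mul, mul_add, add_comm]
  have hnum : 2⁻¹ * a ≤ prior.withDensity
      (fun f : family => ENNReal.ofReal (likelihoodRatio uniformDensity x n f))
      {f : family | likelihoodRatio uniformDensity x n f = Real.exp (Real.log 2 * n)} := by
    have hsub : fittingSteps x n
        ⊆ {f : family | likelihoodRatio uniformDensity x n f = Real.exp (Real.log 2 * n)} :=
      fun f hf => hf.2.trans hexp.symm
    refine le_trans ?_ (measure_mono hsub)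
    have hm := measurableSet_fittingSteps x n
    rw [withDensity_apply _ hm, setLIntegral_congr_fun (g := fun _ => 2 ^ n) hm,
      setLIntegral_const, prior, Measure.add_apply, Measure.smul_apply, Measure.smul_apply,
      smul_eq_mul, smul_eq_mul, ha, mul_left_comm]
    · gcongr
      exact le_add_self
    · intro f hf
      change ENNReal.ofReal (likelihoodRatio uniformDensity x n f) = 2 ^ n
      rw [show likelihoodRatio uniformDensity x n f = 2 ^ n from hf.2]
      simp
  rw [_root_.posterior, Measure.smul_apply, smul_eq_mul, hD]
  refine le_trans (le_of_eq ?_) (mul_le_mul_right hnum _)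
  rw [ENNReal.mul_inv (Or.inl (by simp)) (Or.inl (by simp)), inv_inv, mul_mul_mul_comm,
    ENNReal.mul_inv_cancel two_ne_zero ENNReal.ofNat_ne_top, one_mul]

/-- The ratio of the bounds for the smooth part and for the step part of the evidence. -/
noncomputable def evidenceRatio (n : ℕ) : ℝ≥0∞ :=
  thetaMass⁻¹ * stepWeight univ * ENNReal.ofReal (2 * n ^ 2 * Real.exp (-(√2 - 1) * √n))

theorem tendsto_evidenceRatio : Tendsto evidenceRatio atTop (𝓝 0) := by
  have hc : thetaMass⁻¹ * stepWeight univ ≠ ∞ :=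
    ENNReal.mul_ne_top (ENNReal.inv_ne_top.mpr thetaMass_ne_zero) stepWeight_univ_ne.2
  have hreal : Tendsto (fun n : ℕ => 2 * (n : ℝ) ^ 2 * Real.exp (-(√2 - 1) * √n)) atTop
      (𝓝 0) := by
    have h2 : 0 < √2 - 1 := by
      rw [sub_pos]; exact Real.lt_sqrt_of_sq_lt (by norm_num)
    have h := ((tendsto_rpow_mul_exp_neg_mul_atTop_nhds_zero 4 _ h2).comp
      (Real.tendsto_sqrt_atTop.comp tendsto_natCast_atTop_atTop)).const_mul 2
    rw [mul_zero] at h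
    refine h.congr fun n => ?_
    simp only [Function.comp_apply]
    rw [show (4 : ℝ) = ((2 * 2 : ℕ) : ℝ) by norm_num, Real.rpow_natCast, pow_mul,
      Real.sq_sqrt (by positivity), mul_assoc]
  have h := ENNReal.Tendsto.const_mul (ENNReal.tendsto_ofReal hreal) (Or.inr hc)
  rw [ENNReal.ofReal_zero, mul_zero] at h
  exact h

theorem inv_one_add_evidenceRatio_le_posterior {x : ℕ → Sample} (hx : ∀ i, 0 < (x i : ℝ)) {n : ℕ}
    (hn : 0 < n) (hs : ∑ i ∈ Finset.range n, PhiInv (x i) ≤ √n * √(√n)) :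
    (1 + evidenceRatio n)⁻¹ ≤ posterior prior uniformDensity x n
      {f : family | likelihoodRatio uniformDensity x n f = Real.exp (Real.log 2 * n)} := by
  refine le_trans ?_ (le_posterior x n)
  have ha := le_priorStep_fittingSteps x hn
  have hb := lintegral_likelihoodRatio_prior₀_le hx hn hs
  obtain ⟨hZ0, hZ1⟩ := stepWeight_univ_ne
  have hn0 : (n : ℝ≥0∞) ≠ 0 := by exact_mod_cast hn.ne'
  set a := 2 ^ n * priorStep (fittingSteps x n)
  set b := ∫⁻ g : family, ENNReal.ofReal (likelihoodRatio uniformDensity x n g) ∂prior₀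
  have ha0 : a ≠ 0 := by
    refine (lt_of_lt_of_le ?_ ha).ne'
    refine pos_iff_ne_zero.mpr (mul_ne_zero (mul_ne_zero (ENNReal.inv_ne_zero.mpr hZ1) ?_) ?_)
    · exact ENNReal.inv_ne_zero.mpr (ENNReal.pow_ne_top (ENNReal.natCast_ne_top n))
    · simp
  have ha1 : a ≠ ∞ := ENNReal.mul_ne_top (by simp) (measure_ne_top _ _)
  have hba : b ≤ evidenceRatio n * a := by
    refine hb.trans (le_trans (le_of_eq ?_) (mul_le_mul_right ha _))
    set e := Real.exp (-(√2 - 1) * √n)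
    have he : ENNReal.ofReal (2 * n ^ 2 * e) = 2 * (n : ℝ≥0∞) ^ 2 * ENNReal.ofReal e := by
      rw [ENNReal.ofReal_mul (by positivity), ENNReal.ofReal_mul (by norm_num),
        ENNReal.ofReal_pow (by positivity)]
      simp
    rw [evidenceRatio, he]
    calc thetaMass⁻¹ * ENNReal.ofReal e
        = thetaMass⁻¹ * ENNReal.ofReal e * (stepWeight univ * (stepWeight univ)⁻¹)
          * ((n : ℝ≥0∞) ^ 2 * ((n : ℝ≥0∞) ^ 2)⁻¹) * (2 * 2⁻¹) := by
          rw [ENNReal.mul_inv_cancel hZ0 hZ1, ENNReal.mul_inv_cancel (pow_ne_zero 2 hn0)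
            (ENNReal.pow_ne_top (ENNReal.natCast_ne_top n)),
            ENNReal.mul_inv_cancel two_ne_zero ENNReal.ofNat_ne_top, mul_one, mul_one, mul_one]
      _ = _ := by ring
  calc (1 + evidenceRatio n)⁻¹ = ((1 + evidenceRatio n) * a)⁻¹ * a := by
        rw [ENNReal.mul_inv (Or.inr ha1) (Or.inr ha0), mul_assoc,
          ENNReal.inv_mul_cancel ha0 ha1, mul_one]
    _ ≤ (a + b)⁻¹ * a := by
        gcongr
        rw [add_mul, one_mul]
        gcongr

end Barron

theorem mainTheorem3 :
    GammaInconsistent Barron.prior Barron.uniformDensity (Real.log 2) := by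
  unfold GammaInconsistent
  filter_upwards [Barron.ae_forall_pos, Barron.ae_eventually_sum_PhiInv_lt] with x hx hs
  have hlow : Tendsto (fun n => (1 + Barron.evidenceRatio n)⁻¹) atTop (𝓝 1) := by
    have h := (Barron.tendsto_evidenceRatio.const_add 1).inv
    rwa [add_zero, inv_one] at h
  refine (tendsto_of_tendsto_of_tendsto_of_le_of_le' hlow tendsto_const_nhds ?_ ?_).limsup_eq
  · filter_upwards [hs, eventually_gt_atTop 0] with n hn hn0
    exact Barron.inv_one_add_evidenceRatio_le_posterior hx hn0 hn.le
  · exact Eventually.of_forall fun n => Barron.posterior_le_one x n _
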